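/- Let $k\ge 1$ and $n>2k$ be integers, let $s\le -1$ be real, and let $\Omega\subset\mathbb{R}^n$ be a bounded domain (open, connected) containing the origin, for instance a bounded $(k-1)$-convex domain. For a real symmetric $n\times n$ matrix $A$ with eigenvalues $\lambda_1,\dots,\lambda_n$ put $S_j(A)=\sum_{i_1<\dots<i_j}\lambda_{i_1}\cdots\lambda_{i_j}$. Let $f\in C^1((-\infty,0))$ be positive and monotone decreasing (i.e. nonincreasing), with $$\int_{-\infty}^{-\varepsilon} f(z)^{-1/k}\,dz<\infty\qquad\text{for every }\varepsilon>0 .$$ Given $u:\overline\Omega\to\mathbb{R}$ and $x_0\in\Omega$, say that $\varphi$ touches $u$ from above at $x_0$ if $\varphi$ is of class $C^2$ near $x_0$ and $u-\varphi$ has a local maximum at $x_0$. Let $\Phi_0^k(\Omega)$ be the set of $k$-admissible functions vanishing on $\partial\Omega$, $k$-admissibility being understood in the viscosity sense: $u$ is upper semicontinuous in $\Omega$, and $S_j(D^2\varphi(x_0))\ge 0$ for $j=1,\dots,k$ whenever $\varphi$ touches $u$ from above at some $x_0\in\Omega$. Suppose that $u\in C^0(\overline\Omega)\cap\Phi_0^k(\Omega)$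 is a viscosity subsolution of $$S_k(D^2u)=|x|^{2sk}f(u)\ \text{ in }\Omega,\qquad u=0\ \text{ on }\partial\Omega,$$ meaning that $$S_k(D^2\varphi(x_0))\ \ge\ |x_0|^{2sk}f(u(x_0))$$ whenever $\varphi$ touches $u$ from above at a point $x_0\in\Omega\setminus\{0\}$ with $u(x_0)<0$. (Nothing is required where the right-hand side is not defined, i.e. at $x_0=0$ or where $u(x_0)\ge 0$.) Then $u\equiv 0$ on $\overline\Omega$. -/

import Mathlib

noncomputable section

/-- The Hessian matrix `D²φ(x)` of a real function on `ℝⁿ`: its `(i, j)` entry is the second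
partial derivative in the directions of the standard basis vectors `eᵢ`, `eⱼ`. -/
def hessianMatrix {n : ℕ} (φ : EuclideanSpace ℝ (Fin n) → ℝ) (x : EuclideanSpace ℝ (Fin n)) :
    Matrix (Fin n) (Fin n) ℝ :=
  Matrix.of fun i j =>
    iteratedFDeriv ℝ 2 φ x ![EuclideanSpace.single i (1 : ℝ), EuclideanSpace.single j (1 : ℝ)]

/-- The eigenvalues `λ(D²φ(x))` of the Hessian matrix, counted with multiplicity. (For `φ` of
class `C²` near `x` the matrix is symmetric, so that there are `n` of them.) -/
def hessianEigenvalues {n : ℕ} (φ : EuclideanSpace ℝ (Fin n) → ℝ)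
    (x : EuclideanSpace ℝ (Fin n)) : Multiset ℝ :=
  (hessianMatrix φ x).charpoly.roots

/-- The `k`-Hessian operator `S_k(D²φ)(x) = σ_k(λ(D²φ(x)))`, where `σ_k` is the `k`-th elementary
symmetric polynomial. -/
def hessianOp {n : ℕ} (k : ℕ) (φ : EuclideanSpace ℝ (Fin n) → ℝ)
    (x : EuclideanSpace ℝ (Fin n)) : ℝ :=
  (hessianEigenvalues φ x).esymm k

/-- `φ` is a test function for `u` from above at `x₀`: it is of class `C²` in a neighbourhood of
`x₀` and `u - φ` has a local maximum at `x₀`. -/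
def TouchesFromAbove {n : ℕ} (u φ : EuclideanSpace ℝ (Fin n) → ℝ)
    (x₀ : EuclideanSpace ℝ (Fin n)) : Prop :=
  ContDiffAt ℝ 2 φ x₀ ∧ IsLocalMax (fun x => u x - φ x) x₀

/-- The class `Φ^k(Ω)` of (not necessarily smooth, real valued) `k`-admissible functions on an
open set `Ω`: upper semicontinuous functions with `λ(D²u) ∈ closure Γ_k` in the viscosity sense,
where `closure Γ_k = {λ | σ_j(λ) ≥ 0 for j = 1, …, k}` is the closed Gårding cone. -/
def PhiK {n : ℕ} (k : ℕ) (Ω : Set (EuclideanSpace ℝ (Fin n))) :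
    Set (EuclideanSpace ℝ (Fin n) → ℝ) :=
  {u | UpperSemicontinuousOn u Ω ∧
    ∀ x₀ ∈ Ω, ∀ φ, TouchesFromAbove u φ x₀ → ∀ j : ℕ, 1 ≤ j → j ≤ k → 0 ≤ hessianOp j φ x₀}

/-- The class `Φ_0^k(Ω)` of `k`-admissible functions that vanish on `∂Ω`. -/
def PhiK0 {n : ℕ} (k : ℕ) (Ω : Set (EuclideanSpace ℝ (Fin n))) :
    Set (EuclideanSpace ℝ (Fin n) → ℝ) :=
  {u | u ∈ PhiK k Ω ∧ ∀ x ∈ frontier Ω, u x = 0}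

/-- `u` is a viscosity subsolution of `S_k(D²u) = |x|^{2sk} f(u)` in `Ω`, where `f` is a function
on the negative half-line. The inequality is required at the points where the right-hand side is
a finite number, i.e. `x₀ ≠ 0` (here `s` may be negative) and `u(x₀) < 0`; nothing is required at
the other points. -/
def IsViscositySubsolution {n : ℕ} (k : ℕ) (s : ℝ) (f : ℝ → ℝ)
    (Ω : Set (EuclideanSpace ℝ (Fin n))) (u : EuclideanSpace ℝ (Fin n) → ℝ) : Prop :=
  ∀ x₀ ∈ Ω, x₀ ≠ 0 → u x₀ < 0 → ∀ φ, TouchesFromAbove u φ x₀ →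
    ‖x₀‖ ^ (2 * s * (k : ℝ)) * f (u x₀) ≤ hessianOp k φ x₀

end

/-! The `k`-Hessian inequality is weakened to one for the Laplacian, whose singularity `|x|⁻²` is
too strong at the origin. Admissibility gives `S₁ ≥ 0`, so `u` is viscosity subharmonic: `u ≤ 0`,
and if `u` is not identically zero, the strong maximum principle gives `u < 0` throughout `Ω`. On
the Gårding cone `S_k ≤ C S₁ ^ k` with `C = n.choose k`, and `2s ≤ -2`, so near `0` formally `g(u)
Δu ≥ c |x|⁻²`, where `g = f ^ (-1/k)` and `c = 1/C`. Since `g` is nondecreasing and integrable at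
`-∞`, its primitive `F(z) = ∫_{-∞}^z g` is convex and nonnegative, and `Δ F(u) ≥ c |x|⁻²`.
Comparison (`setIntegral_Iic_le_of_subsolution`) bounds `F(u)` by `F(m) + a (|x|^θ - R^θ)/θ + δ/|x|`
with `a = c/n` and `m` the maximum of `u` on the ball. Letting `δ` and `x` tend to `0` gives `a
R^θ/θ ≤ F(m)`, which fails for small `θ` (`false_of_subsolution_near_zero`). -/

/-! ### Elementary symmetric functions on the Gårding cone. -/

theorem Multiset.sum_sq_eq_sum_sq_add_two_esymm (s : Multiset ℝ) :
    s.sum ^ 2 = (s.map (· ^ 2)).sum + 2 * s.esymm 2 := by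
  induction s using Multiset.induction_on with
  | empty => simp [Multiset.esymm, Multiset.powersetCard_zero_right]
  | cons a s ih =>
    have h : (a ::ₘ s).esymm 2 = s.esymm 2 + a * s.sum := by
      have := Multiset.sum_map_mul_left (s := s) (a := a) (f := id)
      simpa [Multiset.esymm, Multiset.powersetCard_cons, Multiset.powersetCard_one,
        Multiset.map_map] using this
    rw [h, Multiset.sum_cons, Multiset.map_cons, Multiset.sum_cons]
    linear_combination ih

theorem Multiset.esymm_one_eq_sum (s : Multiset ℝ) : s.esymm 1 = s.sum := by
  simp [Multiset.esymm, Multiset.powersetCard_one, Multiset.map_map]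

/-- If the first two elementary symmetric functions are nonnegative, every entry is bounded by
the sum. -/
theorem Multiset.abs_le_sum_of_esymm_two_nonneg (s : Multiset ℝ) (h1 : 0 ≤ s.sum)
    (h2 : 0 ≤ s.esymm 2) {a : ℝ} (ha : a ∈ s) : |a| ≤ s.sum := by
  apply abs_le_of_sq_le_sq' _ h1 |> abs_le.mpr
  have h := s.sum_sq_eq_sum_sq_add_two_esymm
  have : a ^ 2 ≤ (s.map (· ^ 2)).sum := by
    apply Multiset.single_le_sum
    · intro x hx
      obtain ⟨y, -, rfl⟩ := Multiset.mem_map.1 hx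
      positivity
    · exact Multiset.mem_map_of_mem _ ha
  linarith

theorem Multiset.abs_prod_le_pow (s : Multiset ℝ) {T : ℝ} (h : ∀ a ∈ s, |a| ≤ T) :
    |s.prod| ≤ T ^ s.card := by
  induction s using Multiset.induction_on with
  | empty => simp
  | cons a s ih =>
    have ha := h a (Multiset.mem_cons_self a s)
    rw [Multiset.prod_cons, Multiset.card_cons, abs_mul, pow_succ']
    exact mul_le_mul ha (ih fun b hb => h b (Multiset.mem_cons_of_mem hb)) (abs_nonneg _)
      ((abs_nonneg a).trans ha)

/-- A crude form of Maclaurin's inequality on the closed Gårding cone. -/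
theorem Multiset.esymm_le_choose_mul_sum_pow (s : Multiset ℝ) {k : ℕ} (hk : 1 ≤ k)
    (h : ∀ j, 1 ≤ j → j ≤ k → 0 ≤ s.esymm j) :
    s.esymm k ≤ (s.card.choose k : ℝ) * s.sum ^ k := by
  have h1 : 0 ≤ s.sum := s.esymm_one_eq_sum ▸ h 1 le_rfl hk
  rcases hk.eq_or_lt with rfl | hk2
  -- For `k = 1` nothing is known about the sign of `S₂`, so the entrywise bound is not available.
  · rw [s.esymm_one_eq_sum, pow_one, Nat.choose_one_right]
    rcases s.card.eq_zero_or_pos with h0 | h0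
    · simp [Multiset.card_eq_zero.1 h0]
    · exact le_mul_of_one_le_left h1 (by exact_mod_cast h0)
  · have h2 : 0 ≤ s.esymm 2 := h 2 (by norm_num) hk2
    have := Multiset.sum_le_card_nsmul ((s.powersetCard k).map Multiset.prod) (s.sum ^ k) (by
      intro x hx
      obtain ⟨t, ht, rfl⟩ := Multiset.mem_map.1 hx
      obtain ⟨hts, hc⟩ := Multiset.mem_powersetCard.1 ht
      rw [← hc]
      exact (le_abs_self _).trans (t.abs_prod_le_pow fun a ha =>
        s.abs_le_sum_of_esymm_two_nonneg h1 h2 (Multiset.mem_of_le hts ha)))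
    simpa [Multiset.esymm, Multiset.card_powersetCard, nsmul_eq_mul] using this

/-! ### The Hessian operator and Laplacians of radial functions. -/

section Hessian

variable {n : ℕ} {φ : EuclideanSpace ℝ (Fin n) → ℝ} {x : EuclideanSpace ℝ (Fin n)}

theorem hessianMatrix_isHermitian (h : ContDiffAt ℝ 2 φ x) : (hessianMatrix φ x).IsHermitian := by
  ext i j
  simpa [hessianMatrix, iteratedFDeriv_two_apply] using
    (h.isSymmSndFDerivAt (by simp)).eq _ _

theorem hessianEigenvalues_eq (h : ContDiffAt ℝ 2 φ x) :
    hessianEigenvalues φ x =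
      Finset.univ.val.map (hessianMatrix_isHermitian h).eigenvalues := by
  simpa [hessianEigenvalues] using (hessianMatrix_isHermitian h).roots_charpoly_eq_eigenvalues

theorem card_hessianEigenvalues (h : ContDiffAt ℝ 2 φ x) :
    (hessianEigenvalues φ x).card = n := by
  simp [hessianEigenvalues_eq h]

theorem sum_hessianEigenvalues (h : ContDiffAt ℝ 2 φ x) :
    (hessianEigenvalues φ x).sum = (hessianMatrix φ x).trace := by
  rw [hessianEigenvalues_eq h, (hessianMatrix_isHermitian h).trace_eq_sum_eigenvalues]
  rfl

theorem hessianOp_one (h : ContDiffAt ℝ 2 φ x) : hessianOp 1 φ x = (hessianMatrix φ x).trace := by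
  rw [hessianOp, Multiset.esymm_one_eq_sum, sum_hessianEigenvalues h]

theorem hessianOp_le_choose_mul_trace_pow (h : ContDiffAt ℝ 2 φ x) {k : ℕ} (hk : 1 ≤ k)
    (hpos : ∀ j, 1 ≤ j → j ≤ k → 0 ≤ hessianOp j φ x) :
    hessianOp k φ x ≤ (n.choose k : ℝ) * (hessianMatrix φ x).trace ^ k := by
  have := (hessianEigenvalues φ x).esymm_le_choose_mul_sum_pow hk hpos
  rwa [card_hessianEigenvalues h, sum_hessianEigenvalues h] at this

/-- The Laplacian of the radial function `P (‖x - y‖ ^ 2)`. -/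
theorem trace_hessianMatrix_radial {P P' : ℝ → ℝ} {P'' : ℝ} {y : EuclideanSpace ℝ (Fin n)}
    (hxy : x ≠ y) (hP : ∀ t > 0, HasDerivAt P (P' t) t)
    (hP' : HasDerivAt P' P'' (‖x - y‖ ^ 2)) :
    (hessianMatrix (fun z => P (‖z - y‖ ^ 2)) x).trace =
      4 * ‖x - y‖ ^ 2 * P'' + 2 * n * P' (‖x - y‖ ^ 2) := by
  have hsq (z : EuclideanSpace ℝ (Fin n)) :
      HasFDerivAt (fun z => ‖z - y‖ ^ 2) (2 • innerSL ℝ (z - y)) z := by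
    simpa using ((hasFDerivAt_id z).sub_const y).norm_sq
  have h1 : ∀ z, z ≠ y → HasFDerivAt (fun z => P (‖z - y‖ ^ 2))
      (P' (‖z - y‖ ^ 2) • (2 • innerSL ℝ (z - y))) z := fun z hz =>
    (hP _ (by have := norm_pos_iff.2 (sub_ne_zero.2 hz); positivity)).comp_hasFDerivAt z (hsq z)
  have h2 : fderiv ℝ (fun z => P (‖z - y‖ ^ 2)) =ᶠ[nhds x]
      fun z => P' (‖z - y‖ ^ 2) • (2 • innerSL ℝ (z - y)) := by
    filter_upwards [isOpen_ne.mem_nhds hxy] with z hz using (h1 z hz).fderiv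
  have h3 : HasFDerivAt (fun z : EuclideanSpace ℝ (Fin n) =>
      2 • innerSL ℝ (z - y)) (2 • innerSL ℝ) x := by
    exact ((innerSL ℝ).hasFDerivAt.comp x ((hasFDerivAt_id x).sub_const y)).const_smul 2
  have h4 := ((hP'.comp_hasFDerivAt x (hsq x)).smul h3).congr_of_eventuallyEq h2
  have h5 : ∀ i, hessianMatrix (fun z => P (‖z - y‖ ^ 2)) x i i =
      4 * P'' * (x i - y i) ^ 2 + 2 * P' (‖x - y‖ ^ 2) := by
    intro i
    simp [hessianMatrix, iteratedFDeriv_two_apply, h4.fderiv, EuclideanSpace.inner_single_right]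
    erw [innerSL_apply_apply]
    simp
    ring
  simp only [Matrix.trace, Matrix.diag, h5, Finset.sum_add_distrib, ← Finset.mul_sum]
  rw [EuclideanSpace.real_norm_sq_eq]
  simp
  ring

theorem contDiffAt_radial {P : ℝ → ℝ} {y : EuclideanSpace ℝ (Fin n)}
    (hP : ContDiffAt ℝ 2 P (‖x - y‖ ^ 2)) : ContDiffAt ℝ 2 (fun z => P (‖z - y‖ ^ 2)) x :=
  hP.comp x ((contDiffAt_id.sub contDiffAt_const).norm_sq ℝ)

end Hessian

/-! ### Maximum principles for viscosity subharmonic functions. -/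

section Barrier

variable {n : ℕ} {u : EuclideanSpace ℝ (Fin n) → ℝ} {x y : EuclideanSpace ℝ (Fin n)}

/-- A combination of two powers of the squared distance to `y`. -/
noncomputable def powerBarrier (y : EuclideanSpace ℝ (Fin n)) (a p b q : ℝ) (x : EuclideanSpace ℝ (Fin n)) : ℝ :=
  a * (‖x - y‖ ^ 2) ^ p + b * (‖x - y‖ ^ 2) ^ q

theorem contDiffAt_powerBarrier (hxy : x ≠ y) (a p b q : ℝ) :
    ContDiffAt ℝ 2 (powerBarrier y a p b q) x := by
  have h : ‖x - y‖ ^ 2 ≠ 0 := by simpa [sub_eq_zero] using hxy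
  exact contDiffAt_radial (P := fun t => a * t ^ p + b * t ^ q)
    ((contDiffAt_const.mul (Real.contDiffAt_rpow_const_of_ne h)).add
      (contDiffAt_const.mul (Real.contDiffAt_rpow_const_of_ne h)))

/-- The sign of `2p(2p - 2 + n)` decides which powers `|x - y| ^ (2p)` are sub- or superharmonic;
every barrier below is tested through it. -/
theorem trace_hessianMatrix_powerBarrier (hxy : x ≠ y) (a p b q : ℝ) :
    (hessianMatrix (powerBarrier y a p b q) x).trace =
      a * (2 * p * (2 * p - 2 + n)) * (‖x - y‖ ^ 2) ^ (p - 1) +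
      b * (2 * q * (2 * q - 2 + n)) * (‖x - y‖ ^ 2) ^ (q - 1) := by
  have ht : 0 < ‖x - y‖ ^ 2 := by
    have := norm_pos_iff.2 (sub_ne_zero.2 hxy)
    positivity
  have hd (r : ℝ) {t : ℝ} (ht : 0 < t) : HasDerivAt (fun t : ℝ => t ^ r) (r * t ^ (r - 1)) t :=
    Real.hasDerivAt_rpow_const (Or.inl ht.ne')
  have h := trace_hessianMatrix_radial (P := fun t => a * t ^ p + b * t ^ q)
    (P' := fun t => a * (p * t ^ (p - 1)) + b * (q * t ^ (q - 1))) hxy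
    (fun t ht => ((hd p ht).const_mul a).add ((hd q ht).const_mul b))
    ((((hd (p - 1) ht).const_mul p).const_mul a).add (((hd (q - 1) ht).const_mul q).const_mul b))
  refine h.trans ?_
  generalize ‖x - y‖ ^ 2 = t at ht
  have e (r : ℝ) : t * t ^ (r - 1 - 1) = t ^ (r - 1) := by
    rw [Real.rpow_sub_one ht.ne' (r - 1)]
    field_simp
  linear_combination 4 * a * p * (p - 1) * e p + 4 * b * q * (q - 1) * e q

/-- Viscosity subharmonicity. -/
def ViscositySubharmonicOn (Ω : Set (EuclideanSpace ℝ (Fin n)))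
    (u : EuclideanSpace ℝ (Fin n) → ℝ) : Prop :=
  ∀ x₀ ∈ Ω, ∀ φ, TouchesFromAbove u φ x₀ → 0 ≤ (hessianMatrix φ x₀).trace

/-- At a positive maximum, adding a small `η |x - y|²` keeps the maximum interior, and `-η |x - y|²`
then touches from above with negative Laplacian. -/
theorem ViscositySubharmonicOn.nonpos {Ω : Set (EuclideanSpace ℝ (Fin n))}
    (h : ViscositySubharmonicOn Ω u) (hn : 0 < n) (hΩo : IsOpen Ω) (hΩb : Bornology.IsBounded Ω)
    (hu : ContinuousOn u (closure Ω)) (hu0 : ∀ x ∈ frontier Ω, u x = 0) :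
    ∀ x ∈ closure Ω, u x ≤ 0 := by
  intro x₁ hx₁
  by_contra! hM
  obtain ⟨R, hR0, hR⟩ := hΩb.closure.exists_pos_norm_le
  -- The centre lies off `closure Ω`, since the Laplacian formula holds only away from it.
  obtain ⟨y, hy⟩ : ∃ y : EuclideanSpace ℝ (Fin n), ‖y‖ = R + 1 :=
    ⟨EuclideanSpace.single ⟨0, hn⟩ (R + 1), by
      rw [PiLp.norm_single, Real.norm_of_nonneg (by positivity)]⟩
  have hd : ∀ x ∈ closure Ω, ‖x - y‖ ≤ 2 * R + 1 := fun x hx => by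
    have := norm_sub_le x y
    have := hR x hx
    linarith
  set η : ℝ := u x₁ / (2 * (2 * R + 1) ^ 2) with hη
  have hη0 : 0 < η := by positivity
  obtain ⟨x₀, hx₀, hmax⟩ := hΩb.isCompact_closure.exists_isMaxOn ⟨x₁, hx₁⟩
    (f := fun x => u x - powerBarrier y (-η) 1 0 1 x) (by
      refine hu.sub (Continuous.continuousOn ?_)
      unfold powerBarrier
      simp only [Real.rpow_one]
      fun_prop)
  have hx₀Ω : x₀ ∈ Ω := by
    by_contra hx
    have h0 := hu0 x₀ ⟨hx₀, by rwa [hΩo.interior_eq]⟩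
    have h1 := hmax hx₁
    simp only [Set.mem_ofPred_eq, powerBarrier, Real.rpow_one, h0] at h1
    have h2 : η * ‖x₀ - y‖ ^ 2 ≤ u x₁ / 2 := by
      have : η * (2 * R + 1) ^ 2 = u x₁ / 2 := by rw [hη]; field_simp
      rw [← this]
      gcongr
      exact hd x₀ hx₀
    have h3 : 0 ≤ η * ‖x₁ - y‖ ^ 2 := by positivity
    linarith
  have hne : x₀ ≠ y := by
    rintro rfl
    linarith [hR x₀ hx₀]
  have := h x₀ hx₀Ω _ ⟨contDiffAt_powerBarrier hne (-η) 1 0 1,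
    Filter.eventually_of_mem (hΩo.mem_nhds hx₀Ω) fun x hx => hmax (subset_closure hx)⟩
  rw [trace_hessianMatrix_powerBarrier hne] at this
  have hn' : (0 : ℝ) < n := by exact_mod_cast hn
  norm_num at this
  nlinarith

/-- Hopf's lemma: a nonpositive subharmonic function cannot vanish at a point `z` of a sphere
while being negative elsewhere on the closed ball it bounds. -/
theorem ViscositySubharmonicOn.hopf {Ω : Set (EuclideanSpace ℝ (Fin n))}
    (h : ViscositySubharmonicOn Ω u) (hn : 0 < n) (hu : ContinuousOn u Ω)
    (hu0 : ∀ x ∈ Ω, u x ≤ 0) {z : EuclideanSpace ℝ (Fin n)} {ρ : ℝ} (hρ : 0 < ρ)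
    (hz : dist z y = ρ) (hzΩ : Metric.closedBall z (ρ / 2) ⊆ Ω) (huz : u z = 0)
    (hneg : ∀ w ∈ Ω, dist w y ≤ ρ → w ≠ z → u w < 0) : False := by
  have hfar : ∀ w ∈ Metric.closedBall z (ρ / 2), ρ / 2 ≤ ‖w - y‖ := fun w hw => by
    rw [← dist_eq_norm]
    have h1 := dist_triangle z w y
    rw [dist_comm z w] at h1
    have := Metric.mem_closedBall.1 hw
    linarith
  obtain ⟨m, hm0, hm⟩ : ∃ m > 0, ∀ w ∈ Metric.sphere z (ρ / 2) ∩ Metric.closedBall y ρ,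
      u w ≤ -m := by
    rcases (Metric.sphere z (ρ / 2) ∩ Metric.closedBall y ρ).eq_empty_or_nonempty with he | hne
    · exact ⟨1, one_pos, by simp [he]⟩
    · obtain ⟨w, hw, hmax⟩ := ((isCompact_sphere z (ρ / 2)).inter_right
        Metric.isClosed_closedBall).exists_isMaxOn hne
        (hu.mono fun w hw => hzΩ (Metric.sphere_subset_closedBall hw.1))
      refine ⟨-u w, neg_pos.2 (hneg w (hzΩ (Metric.sphere_subset_closedBall hw.1)) hw.2 ?_),
        fun v hv => by simpa using hmax hv⟩
      rintro rfl
      have := Metric.mem_sphere.1 hw.1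
      rw [dist_self] at this
      linarith
  have hn' : (0 : ℝ) < n := by exact_mod_cast hn
  -- Chosen so that `ε |x - y| ^ (-2n) ≤ m` wherever `|x - y| ≥ ρ / 2`.
  set ε : ℝ := m / ((ρ / 2) ^ 2) ^ (-(n : ℝ)) with hε
  have hpos : 0 < ((ρ / 2) ^ 2) ^ (-(n : ℝ)) := by positivity
  have hε0 : 0 < ε := by positivity
  have hεm : ε * ((ρ / 2) ^ 2) ^ (-(n : ℝ)) = m := by rw [hε]; field_simp
  have hne : ∀ w ∈ Metric.closedBall z (ρ / 2), w ≠ y := by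
    rintro w hw rfl
    have := hfar w hw
    rw [sub_self, norm_zero] at this
    linarith
  have hzmem : z ∈ Metric.closedBall z (ρ / 2) := Metric.mem_closedBall_self (by positivity)
  obtain ⟨x₀, hx₀, hmax⟩ := (isCompact_closedBall z (ρ / 2)).exists_isMaxOn ⟨z, hzmem⟩
    (f := fun x => u x - powerBarrier y (-ε) (-n) 0 1 x) ((hu.mono hzΩ).sub fun w hw =>
      (contDiffAt_powerBarrier (hne w hw) _ _ _ _).continuousAt.continuousWithinAt)
  have hx₀b : x₀ ∈ Metric.ball z (ρ / 2) := by
    by_contra hx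
    have hs : x₀ ∈ Metric.sphere z (ρ / 2) :=
      Metric.mem_sphere.2 (le_antisymm hx₀ (not_lt.1 hx))
    have h1 := hmax hzmem
    simp only [Set.mem_ofPred_eq, powerBarrier, huz] at h1
    rw [← dist_eq_norm z y, hz] at h1
    -- On the part of the small sphere inside the ball, `u ≤ -m` outweighs the perturbation;
    -- outside, the perturbation is strictly smaller than at `z`.
    rcases le_or_gt (dist x₀ y) ρ with hle | hlt
    · have h2 := hm x₀ ⟨hs, hle⟩
      have h3 : (‖x₀ - y‖ ^ 2) ^ (-(n : ℝ)) ≤ ((ρ / 2) ^ 2) ^ (-(n : ℝ)) := by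
        apply Real.rpow_le_rpow_of_nonpos (by positivity)
        · gcongr
          exact hfar x₀ hx₀
        · linarith
      have h4 : 0 < (ρ ^ 2) ^ (-(n : ℝ)) := by positivity
      nlinarith
    · have h2 := hu0 x₀ (hzΩ hx₀)
      rw [dist_eq_norm] at hlt
      have h3 : (‖x₀ - y‖ ^ 2) ^ (-(n : ℝ)) < (ρ ^ 2) ^ (-(n : ℝ)) := by
        apply Real.rpow_lt_rpow_of_neg (by positivity)
        · gcongr
        · linarith
      nlinarith
  have := h x₀ (hzΩ hx₀) _ ⟨contDiffAt_powerBarrier (hne x₀ hx₀) (-ε) (-n) 0 1,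
    Filter.eventually_of_mem (Metric.isOpen_ball.mem_nhds hx₀b)
      fun x hx => hmax (Metric.ball_subset_closedBall hx)⟩
  rw [trace_hessianMatrix_powerBarrier (hne x₀ hx₀)] at this
  have hp : 0 < (‖x₀ - y‖ ^ 2) ^ (-(n : ℝ) - 1) := by
    have := norm_pos_iff.2 (sub_ne_zero.2 (hne x₀ hx₀))
    positivity
  have h5 : 0 < ε * (2 * n * (n + 2)) * (‖x₀ - y‖ ^ 2) ^ (-(n : ℝ) - 1) := by positivity
  linarith

/-- The strong maximum principle. -/
theorem ViscositySubharmonicOn.neg_of_exists_neg {Ω : Set (EuclideanSpace ℝ (Fin n))}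
    (h : ViscositySubharmonicOn Ω u) (hn : 0 < n) (hΩo : IsOpen Ω) (hΩc : IsPreconnected Ω)
    (hu : ContinuousOn u Ω) (hu0 : ∀ x ∈ Ω, u x ≤ 0) (hex : ∃ x ∈ Ω, u x < 0) :
    ∀ x ∈ Ω, u x < 0 := by
  have hNo : IsOpen (Ω ∩ u ⁻¹' Set.Iio 0) := hu.isOpen_inter_preimage hΩo isOpen_Iio
  suffices Ω ⊆ Ω ∩ u ⁻¹' Set.Iio 0 from fun x hx => (this hx).2
  obtain ⟨x₁, hx₁, hux₁⟩ := hex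
  refine hΩc.subset_of_closure_inter_subset hNo ⟨x₁, hx₁, hx₁, hux₁⟩ ?_
  rintro p ⟨hpN, hpΩ⟩
  by_contra hp
  have hup : u p = 0 := le_antisymm (hu0 p hpΩ) (not_lt.1 fun hlt => hp ⟨hpΩ, hlt⟩)
  obtain ⟨r', hr', hball⟩ := Metric.nhds_basis_closedBall.mem_iff.1 (hΩo.mem_nhds hpΩ)
  obtain ⟨r, hr, hball⟩ : ∃ r > 0, Metric.closedBall p (3 * r) ⊆ Ω :=
    ⟨r' / 3, by positivity, by rwa [mul_div_cancel₀ _ (by norm_num : (3 : ℝ) ≠ 0)]⟩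
  obtain ⟨y, ⟨hyΩ, huy⟩, hyp⟩ := Metric.mem_closure_iff.1 hpN r hr
  have hZ : IsCompact (Metric.closedBall p (3 * r) ∩ u ⁻¹' {0}) :=
    (isCompact_closedBall p (3 * r)).of_isClosed_subset
      ((hu.mono hball).preimage_isClosed_of_isClosed Metric.isClosed_closedBall
        isClosed_singleton) Set.inter_subset_left
  have hpZ : p ∈ Metric.closedBall p (3 * r) ∩ u ⁻¹' {0} :=
    ⟨Metric.mem_closedBall_self (by positivity), hup⟩
  obtain ⟨z, ⟨hzb, huz⟩, hzmin⟩ := hZ.exists_isMinOn ⟨p, hpZ⟩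
    (f := fun w => dist w y) (by fun_prop)
  have hzy : dist z y < r := by
    have : dist z y ≤ dist p y := hzmin hpZ
    linarith
  have hzy0 : 0 < dist z y := by
    refine dist_pos.2 ?_
    rintro rfl
    exact (ne_of_lt huy) huz
  have hneg : ∀ w, dist w y < dist z y → u w < 0 := by
    intro w hw
    have hwb : w ∈ Metric.closedBall p (3 * r) := by
      have := dist_triangle w y p
      rw [dist_comm y p] at this
      exact Metric.mem_closedBall.2 (by linarith)
    refine lt_of_le_of_ne (hu0 w (hball hwb)) fun hw0 => ?_
    have : dist z y ≤ dist w y := hzmin ⟨hwb, hw0⟩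
    linarith
  have hmid : dist (midpoint ℝ y z) y = dist z y / 2 := by
    rw [dist_midpoint_left, dist_comm y z, Real.norm_of_nonneg (by norm_num)]
    ring
  -- The half-size ball about the midpoint is internally tangent at `z` to the ball about `y`, so
  -- `z` is the only zero of `u` on it.
  refine h.hopf hn hu hu0 (y := midpoint ℝ y z) (z := z) (ρ := dist z y / 2) (by positivity)
    ?_ ?_ huz ?_
  · rw [dist_right_midpoint, dist_comm y z, Real.norm_of_nonneg (by norm_num)]
    ring
  · intro w hw
    apply hball
    have h1 := dist_triangle w z y
    have h2 := dist_triangle w y p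
    rw [dist_comm y p] at h2
    have h3 := Metric.mem_closedBall.1 hw
    exact Metric.mem_closedBall.2 (by linarith)
  · intro w _ hw hwz
    by_contra hcon
    have h1 : dist z y ≤ dist w y := not_lt.1 fun hlt => hcon (hneg w hlt)
    have h2 := dist_triangle w (midpoint ℝ y z) y
    apply hwz
    have h3 : midpoint ℝ y z = midpoint ℝ y w := by
      apply eq_midpoint_of_dist_eq_half
      · rw [dist_comm, hmid, dist_comm y w]
        linarith
      · rw [dist_comm, dist_comm y w]
        linarith
    have h4 := congrArg (AffineEquiv.pointReflection ℝ · y) h3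
    simpa using h4.symm

end Barrier

/-! ### The convex primitive of `g`. -/

section Primitive

open MeasureTheory

variable {g : ℝ → ℝ}

theorem setIntegral_Iic_sub_mem_Icc (hg : MonotoneOn g (Set.Iio 0))
    (hint : ∀ ε > 0, IntegrableOn g (Set.Iic (-ε))) {a b : ℝ} (hab : a ≤ b) (hb : b < 0) :
    (∫ t in Set.Iic b, g t) - (∫ t in Set.Iic a, g t) ∈ Set.Icc (g a * (b - a)) (g b * (b - a)) := by
  have hi : ∀ z < 0, IntegrableOn g (Set.Iic z) := fun z hz => by
    simpa using hint (-z) (neg_pos.2 hz)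
  have hab' : IntervalIntegrable g volume a b :=
    (intervalIntegrable_iff_integrableOn_Ioc_of_le hab).2 ((hi b hb).mono_set fun t ht => ht.2)
  rw [intervalIntegral.integral_Iic_sub_Iic (hi a (hab.trans_lt hb)) (hi b hb)]
  constructor
  · have := intervalIntegral.integral_mono_on hab intervalIntegrable_const hab'
      fun t ht => hg (hab.trans_lt hb) (ht.2.trans_lt hb) ht.1
    simpa [mul_comm] using this
  · have := intervalIntegral.integral_mono_on hab hab' intervalIntegrable_const
      fun t ht => hg (ht.2.trans_lt hb) hb ht.2
    simpa [mul_comm] using this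

/-- The subgradient inequality for the convex primitive. It lets a test function for `F(u)` be
turned into one for `u` without differentiating `F`. -/
theorem mul_sub_le_setIntegral_Iic_sub (hg : MonotoneOn g (Set.Iio 0))
    (hint : ∀ ε > 0, IntegrableOn g (Set.Iic (-ε))) {a b : ℝ} (ha : a < 0) (hb : b < 0) :
    g a * (b - a) ≤ (∫ t in Set.Iic b, g t) - (∫ t in Set.Iic a, g t) := by
  rcases le_total a b with hab | hab
  · exact (setIntegral_Iic_sub_mem_Icc hg hint hab hb).1
  · have := (setIntegral_Iic_sub_mem_Icc hg hint hab ha).2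
    linarith

theorem continuousOn_setIntegral_Iic (hg : MonotoneOn g (Set.Iio 0)) (hg0 : ∀ z < 0, 0 < g z)
    (hint : ∀ ε > 0, IntegrableOn g (Set.Iic (-ε))) {c : ℝ} (hc : c < 0) :
    ContinuousOn (fun z => ∫ t in Set.Iic z, g t) (Set.Iic c) := by
  have key : ∀ a b : ℝ, a ≤ b → b ≤ c →
      |(∫ t in Set.Iic b, g t) - (∫ t in Set.Iic a, g t)| ≤ g c * |b - a| := by
    intro a b hab hb
    have hb0 := hb.trans_lt hc
    obtain ⟨h1, h2⟩ := setIntegral_Iic_sub_mem_Icc hg hint hab hb0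
    have h3 := mul_nonneg (hg0 a (hab.trans_lt hb0)).le (sub_nonneg.2 hab)
    rw [abs_of_nonneg (h3.trans h1), abs_of_nonneg (sub_nonneg.2 hab)]
    exact h2.trans (mul_le_mul_of_nonneg_right (hg hb0 hc hb) (sub_nonneg.2 hab))
  refine (LipschitzOnWith.of_dist_le_mul (K := (g c).toNNReal) fun x hx y hy => ?_).continuousOn
  rw [Real.dist_eq, Real.dist_eq, Real.coe_toNNReal _ (hg0 c hc).le]
  rcases le_total x y with h | h
  · rw [abs_sub_comm, abs_sub_comm x y]
    exact key x y h hy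
  · exact key y x h hx

end Primitive

/-! ### Comparison near the singularity. -/

section Comparison

open MeasureTheory

variable {n : ℕ} {u : EuclideanSpace ℝ (Fin n) → ℝ} {g : ℝ → ℝ}

/-- Comparison on a punctured ball of `F (u)`, `F' = g`, with the radial supersolution
`a (|x| ^ θ - R ^ θ) / θ + δ / |x|`. -/
theorem setIntegral_Iic_le_of_subsolution (hn : 3 ≤ n) (hg : MonotoneOn g (Set.Iio 0))
    (hg0 : ∀ z < 0, 0 < g z) (hint : ∀ ε > 0, IntegrableOn g (Set.Iic (-ε)))
    {R c m θ δ : ℝ} (hR1 : R ≤ 1) (hc : 0 < c) (hm : m < 0)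
    (hu : ContinuousOn u (Metric.closedBall 0 R)) (hum : ∀ x ∈ Metric.closedBall 0 R, u x ≤ m)
    (hsub : ∀ x₀ ∈ Metric.ball 0 R, x₀ ≠ 0 → ∀ φ, TouchesFromAbove u φ x₀ →
      c * (‖x₀‖ ^ 2)⁻¹ ≤ g (u x₀) * (hessianMatrix φ x₀).trace)
    (hθ : 0 < θ) (hθ1 : θ ≤ 1) (hδ : 0 < δ) {x₁ : EuclideanSpace ℝ (Fin n)} (hx₁0 : x₁ ≠ 0)
    (hx₁ : x₁ ∈ Metric.closedBall 0 R) :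
    (∫ t in Set.Iic (u x₁), g t) ≤ (∫ t in Set.Iic m, g t) - c / n / θ * (R ^ 2) ^ (θ / 2)
      + powerBarrier 0 (c / n / θ) (θ / 2) δ (-1 / 2) x₁ := by
  have hn0 : (3 : ℝ) ≤ n := by exact_mod_cast hn
  set a : ℝ := c / n with ha
  have ha0 : 0 < a := by positivity
  set F : ℝ → ℝ := fun z => ∫ t in Set.Iic z, g t with hF
  set W : EuclideanSpace ℝ (Fin n) → ℝ := powerBarrier 0 (a / θ) (θ / 2) δ (-1 / 2) with hW
  have hW' : ∀ x, W x = a / θ * (‖x‖ ^ 2) ^ (θ / 2) + δ * (‖x‖ ^ 2) ^ (-1 / 2 : ℝ) := fun x => by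
    simp [hW, powerBarrier]
  have hroot : ∀ r : ℝ, 0 ≤ r → (r ^ 2) ^ (-1 / 2 : ℝ) = r⁻¹ := fun r hr => by
    rw [← Real.rpow_natCast, ← Real.rpow_mul hr]
    norm_num [Real.rpow_neg_one]
  have hFle : ∀ x ∈ Metric.closedBall 0 R, F (u x) ≤ F m := fun x hx => by
    have h1 := mul_sub_le_setIntegral_Iic_sub hg hint ((hum x hx).trans_lt hm) hm
    have h2 := mul_nonneg (hg0 _ ((hum x hx).trans_lt hm)).le (sub_nonneg.2 (hum x hx))
    exact sub_nonneg.1 (h2.trans h1)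
  by_contra! hcon
  change F m - a / θ * (R ^ 2) ^ (θ / 2) + W x₁ < F (u x₁) at hcon
  set B : ℝ := a / θ * (R ^ 2) ^ (θ / 2) with hB
  have hx₁n : 0 < ‖x₁‖ := norm_pos_iff.2 hx₁0
  have hR0 : 0 < R := hx₁n.trans_le (mem_closedBall_zero_iff.1 hx₁)
  have hB0 : 0 < B := by positivity
  -- the supersolution exceeds `B` close to the origin
  obtain ⟨r, hr0, hrx, hrB⟩ : ∃ r > 0, r ≤ ‖x₁‖ ∧ B ≤ δ * r⁻¹ :=
    ⟨min ‖x₁‖ (δ / B), by positivity, min_le_left _ _, by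
      rw [← div_eq_mul_inv, le_div_iff₀ (by positivity), ← le_div_iff₀' hB0]
      exact min_le_right _ _⟩
  have hKc : IsCompact (Metric.closedBall (0 : EuclideanSpace ℝ (Fin n)) R ∩ {x | r ≤ ‖x‖}) :=
    (isCompact_closedBall _ _).inter_right (isClosed_le continuous_const continuous_norm)
  have hK0 : ∀ x : EuclideanSpace ℝ (Fin n), r ≤ ‖x‖ → x ≠ 0 := fun x hx =>
    norm_pos_iff.1 (hr0.trans_le hx)
  obtain ⟨x₀, ⟨hx₀, hrx₀⟩, hmax⟩ := hKc.exists_isMaxOn ⟨x₁, hx₁, hrx⟩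
    (f := fun x => F (u x) - W x) (by
      refine ContinuousOn.sub ?_ fun x hx =>
        (contDiffAt_powerBarrier (hK0 x hx.2) _ _ _ _).continuousAt.continuousWithinAt
      exact (continuousOn_setIntegral_Iic hg hg0 hint hm).comp (hu.mono Set.inter_subset_left)
        fun x hx => hum x hx.1)
  have hx₀0 := hK0 x₀ hrx₀
  have hx₀n : 0 < ‖x₀‖ := norm_pos_iff.2 hx₀0
  have hbig : F m - B < F (u x₀) - W x₀ := by
    have : F (u x₁) - W x₁ ≤ F (u x₀) - W x₀ := hmax ⟨hx₁, hrx⟩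
    linarith
  -- As `F(u) ≤ F(m)`, the maximum point has `W < B`, whereas `W ≥ B` on both boundary spheres;
  -- hence it is interior.
  have hlt : W x₀ < B := by linarith [hFle x₀ hx₀]
  rw [hW', hroot _ hx₀n.le] at hlt
  have hx₀R : ‖x₀‖ < R := by
    by_contra! hle
    have h1 : B ≤ a / θ * (‖x₀‖ ^ 2) ^ (θ / 2) := by rw [hB]; gcongr
    have h2 : 0 < δ * ‖x₀‖⁻¹ := by positivity
    linarith
  have hrx₀' : r < ‖x₀‖ := by
    by_contra! hle
    have h1 : δ * r⁻¹ ≤ δ * ‖x₀‖⁻¹ := by gcongr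
    have h2 : 0 < a / θ * (‖x₀‖ ^ 2) ^ (θ / 2) := by positivity
    linarith
  have hu₀ : u x₀ < 0 := (hum x₀ hx₀).trans_lt hm
  have hG := hg0 _ hu₀
  set G : ℝ := g (u x₀) with hGdef
  have htouch : TouchesFromAbove u (powerBarrier 0 (a / θ / G) (θ / 2) (δ / G) (-1 / 2)) x₀ := by
    refine ⟨contDiffAt_powerBarrier hx₀0 _ _ _ _, ?_⟩
    have hnhds : {x : EuclideanSpace ℝ (Fin n) | r < ‖x‖ ∧ ‖x‖ < R} ∈ nhds x₀ :=
      ((isOpen_lt continuous_const continuous_norm).inter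
        (isOpen_lt continuous_norm continuous_const)).mem_nhds ⟨hrx₀', hx₀R⟩
    filter_upwards [hnhds] with x hx
    have hxR : x ∈ Metric.closedBall (0 : EuclideanSpace ℝ (Fin n)) R :=
      mem_closedBall_zero_iff.2 hx.2.le
    have h1 : F (u x) - W x ≤ F (u x₀) - W x₀ := hmax ⟨hxR, hx.1.le⟩
    have h2 : G * (u x - u x₀) ≤ F (u x) - F (u x₀) :=
      mul_sub_le_setIntegral_Iic_sub hg hint hu₀ ((hum x hxR).trans_lt hm)
    have h3 : ∀ x, powerBarrier 0 (a / θ / G) (θ / 2) (δ / G) (-1 / 2) x = W x / G := fun x => by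
      simp only [hW, powerBarrier]
      ring
    rw [h3, h3]
    have h4 : u x - u x₀ ≤ (W x - W x₀) / G := by
      rw [le_div_iff₀' hG]
      linarith
    rw [sub_div] at h4
    linarith
  have h := hsub x₀ (mem_ball_zero_iff.2 hx₀R) hx₀0 _ htouch
  rw [trace_hessianMatrix_powerBarrier hx₀0, sub_zero] at h
  have ht0 : 0 < ‖x₀‖ ^ 2 := by positivity
  have ht1 : ‖x₀‖ ^ 2 ≤ 1 := pow_le_one₀ hx₀n.le (hx₀R.le.trans hR1)
  generalize ‖x₀‖ ^ 2 = t at h ht0 ht1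
  have e1 : t ^ (θ / 2 - 1) ≤ t⁻¹ := by
    rw [Real.rpow_sub_one ht0.ne', ← one_div]
    gcongr
    exact Real.rpow_le_one ht0.le ht1 (by positivity)
  have e2 : G * (a / θ / G * (2 * (θ / 2) * (2 * (θ / 2) - 2 + n)) * t ^ (θ / 2 - 1) +
      δ / G * (2 * (-1 / 2) * (2 * (-1 / 2) - 2 + n)) * t ^ (-1 / 2 - 1 : ℝ)) =
      a * (θ - 2 + n) * t ^ (θ / 2 - 1) - δ * (n - 3) * t ^ (-1 / 2 - 1 : ℝ) := by
    field_simp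
    ring
  rw [e2] at h
  -- `δ/|x|` is superharmonic because `n ≥ 3`.
  have e3 : 0 ≤ δ * (n - 3) * t ^ (-1 / 2 - 1 : ℝ) :=
    mul_nonneg (mul_nonneg hδ.le (by linarith)) (by positivity)
  -- With `θ ≤ 1` the barrier's Laplacian is at most `a (n - 1) |x|⁻²`, strictly below `c |x|⁻² = a
  -- n |x|⁻²`.
  have e4 : a * (θ - 2 + n) * t ^ (θ / 2 - 1) ≤ a * (n - 1) * t⁻¹ := by
    apply mul_le_mul _ e1 (by positivity)
    · exact mul_nonneg ha0.le (by linarith)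
    · exact mul_le_mul_of_nonneg_left (by linarith) ha0.le
  have e5 : c * t⁻¹ = a * n * t⁻¹ := by rw [ha]; field_simp
  have e6 : 0 < a * t⁻¹ := by positivity
  linarith

/-- There is no subsolution of `Δ u ≥ c |x| ^ (-2) / g (u)` that is negative near the origin. -/
theorem false_of_subsolution_near_zero (hn : 3 ≤ n) (hg : MonotoneOn g (Set.Iio 0))
    (hg0 : ∀ z < 0, 0 < g z) (hint : ∀ ε > 0, IntegrableOn g (Set.Iic (-ε)))
    {R c m : ℝ} (hR0 : 0 < R) (hR1 : R ≤ 1) (hc : 0 < c) (hm : m < 0)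
    (hu : ContinuousOn u (Metric.closedBall 0 R)) (hum : ∀ x ∈ Metric.closedBall 0 R, u x ≤ m)
    (hsub : ∀ x₀ ∈ Metric.ball 0 R, x₀ ≠ 0 → ∀ φ, TouchesFromAbove u φ x₀ →
      c * (‖x₀‖ ^ 2)⁻¹ ≤ g (u x₀) * (hessianMatrix φ x₀).trace) : False := by
  have hn0 : (0 : ℝ) < n := by exact_mod_cast (by lia : 0 < n)
  have hFnonneg : ∀ z < 0, 0 ≤ ∫ t in Set.Iic z, g t := fun z hz =>
    setIntegral_nonneg measurableSet_Iic fun t ht => (hg0 t (lt_of_le_of_lt ht hz)).le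
  set V : ℝ := ∫ t in Set.Iic m, g t with hV
  have hV0 : 0 ≤ V := hFnonneg m hm
  have key : ∀ θ : ℝ, 0 < θ → θ ≤ 1 → c / n / θ * (R ^ 2) ^ (θ / 2) ≤ V := by
    intro θ hθ hθ1
    have hlim : Filter.Tendsto
        (fun t : ℝ => V - c / n / θ * (R ^ 2) ^ (θ / 2) + (c / n / θ * (t ^ 2) ^ (θ / 2) + t))
        (nhdsWithin 0 (Set.Ioi 0)) (nhds (V - c / n / θ * (R ^ 2) ^ (θ / 2) +
          (c / n / θ * ((0 : ℝ) ^ 2) ^ (θ / 2) + 0))) := by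
      refine tendsto_nhdsWithin_of_tendsto_nhds (Continuous.tendsto ?_ 0)
      have : Continuous fun t : ℝ => (t ^ 2) ^ (θ / 2) :=
        (continuous_pow 2).rpow_const fun _ => Or.inr (by positivity)
      fun_prop
    have h := ge_of_tendsto (b := 0) hlim (by
      filter_upwards [Ioo_mem_nhdsGT hR0] with t ht
      obtain ⟨x, hx⟩ : ∃ x : EuclideanSpace ℝ (Fin n), ‖x‖ = t :=
        ⟨EuclideanSpace.single ⟨0, by lia⟩ t, by
          rw [PiLp.norm_single, Real.norm_of_nonneg ht.1.le]⟩
      have hxR : x ∈ Metric.closedBall (0 : EuclideanSpace ℝ (Fin n)) R :=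
        mem_closedBall_zero_iff.2 (hx.trans_le ht.2.le)
      -- Taking `δ = t²` at `|x| = t` makes `δ/|x| = t`, so both limits are taken at once.
      have h1 := setIntegral_Iic_le_of_subsolution hn hg hg0 hint hR1 hc hm hu hum hsub hθ hθ1
        (pow_pos ht.1 2) (norm_pos_iff.1 (hx ▸ ht.1)) hxR
      have h2 := hFnonneg (u x) ((hum x hxR).trans_lt hm)
      have h3 : t ^ 2 * (t ^ 2) ^ (-1 / 2 : ℝ) = t := by
        rw [← Real.rpow_natCast, ← Real.rpow_mul ht.1.le, ← Real.rpow_add ht.1]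
        norm_num
      rw [powerBarrier, sub_zero, hx, h3] at h1
      exact h2.trans h1)
    rw [zero_pow two_ne_zero, Real.zero_rpow (by positivity)] at h
    linarith
  -- As `R ^ θ ≥ R`, the choice `θ = b / (V + 1 + b)` gives `a R ^ θ / θ ≥ b / θ = V + 1 + b > V`.
  set b : ℝ := c / n * R with hb
  have hb0 : 0 < b := by positivity
  have hθ0 : 0 < b / (V + 1 + b) := by positivity
  have hθ1 : b / (V + 1 + b) ≤ 1 := (div_le_one (by positivity)).2 (by linarith)
  have h := key _ hθ0 hθ1
  have hRθ : R ≤ (R ^ 2) ^ (b / (V + 1 + b) / 2) := by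
    rw [← Real.rpow_natCast, ← Real.rpow_mul hR0.le]
    calc R = R ^ (1 : ℝ) := (Real.rpow_one R).symm
      _ ≤ _ := Real.rpow_le_rpow_of_exponent_ge hR0 hR1 (by push_cast; linarith)
  have h2 : c / n / (b / (V + 1 + b)) * R ≤ V := by
    refine le_trans ?_ h
    gcongr
  have h3 : c / n / (b / (V + 1 + b)) * R = V + 1 + b := by
    rw [hb]
    field_simp
  linarith

end Comparison

/-! ### Reduction of the `k`-Hessian inequality to the Laplacian. -/

theorem theorem1p5 (n k : ℕ) (hk : 1 ≤ k) (hn : 2 * k < n) (s : ℝ) (hs : s ≤ -1)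
    (Ω : Set (EuclideanSpace ℝ (Fin n))) (hΩo : IsOpen Ω) (hΩc : IsConnected Ω)
    (hΩb : Bornology.IsBounded Ω) (h0 : (0 : EuclideanSpace ℝ (Fin n)) ∈ Ω)
    (f : ℝ → ℝ) (hf : ContDiffOn ℝ 1 f (Set.Iio 0)) (hfpos : ∀ z < 0, 0 < f z)
    (hfanti : AntitoneOn f (Set.Iio 0))
    (hfint : ∀ ε > 0, MeasureTheory.IntegrableOn (fun z => f z ^ (-(1 / (k : ℝ)))) (Set.Iic (-ε)))
    (u : EuclideanSpace ℝ (Fin n) → ℝ) (hu : ContinuousOn u (closure Ω)) (huΦ : u ∈ PhiK0 k Ω)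
    (husub : IsViscositySubsolution k s f Ω u) :
    ∀ x ∈ closure Ω, u x = 0 := by
  obtain ⟨⟨-, hadm⟩, hfr⟩ := huΦ
  have hsubh : ViscositySubharmonicOn Ω u := fun x₀ hx₀ φ hφ => by
    rw [← hessianOp_one hφ.1]
    exact hadm x₀ hx₀ φ hφ 1 le_rfl hk
  have hnonpos := hsubh.nonpos (by lia) hΩo hΩb hu hfr
  by_contra! hne
  obtain ⟨x₁, hx₁, hux₁⟩ := hne
  have hx₁Ω : x₁ ∈ Ω := by
    by_contra hx
    exact hux₁ (hfr x₁ ⟨hx₁, by rwa [hΩo.interior_eq]⟩)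
  have huΩ : ContinuousOn u Ω := hu.mono subset_closure
  have hneg := hsubh.neg_of_exists_neg (by lia) hΩo hΩc.isPreconnected huΩ
    (fun x hx => hnonpos x (subset_closure hx))
    ⟨x₁, hx₁Ω, lt_of_le_of_ne (hnonpos x₁ hx₁) hux₁⟩
  obtain ⟨R', hR', hball⟩ := Metric.nhds_basis_closedBall.mem_iff.1 (hΩo.mem_nhds h0)
  obtain ⟨R, hR0, hR1, hRΩ⟩ : ∃ R > 0, R ≤ 1 ∧
      Metric.closedBall (0 : EuclideanSpace ℝ (Fin n)) R ⊆ Ω :=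
    ⟨min R' 1, by positivity, min_le_right _ _,
      (Metric.closedBall_subset_closedBall (min_le_left _ _)).trans hball⟩
  obtain ⟨xm, hxm, hmax⟩ := (isCompact_closedBall (0 : EuclideanSpace ℝ (Fin n)) R).exists_isMaxOn
    ⟨0, Metric.mem_closedBall_self hR0.le⟩ (huΩ.mono hRΩ)
  have hk0 : (0 : ℝ) < k := by exact_mod_cast hk
  have hCN : 1 ≤ n.choose k := Nat.choose_pos (by lia)
  have hC : (1 : ℝ) ≤ n.choose k := by exact_mod_cast hCN
  set C : ℝ := ((n.choose k : ℕ) : ℝ)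
  refine false_of_subsolution_near_zero (g := fun z => f z ^ (-(1 / (k : ℝ)))) (c := 1 / C)
    (R := R) (m := u xm) (u := u) (by lia) ?_ (fun z hz => Real.rpow_pos_of_pos (hfpos z hz) _)
    hfint hR0 hR1 (by positivity) (hneg xm (hRΩ hxm)) (huΩ.mono hRΩ) (fun x hx => hmax hx) ?_
  · intro z hz w hw hzw
    exact Real.rpow_le_rpow_of_nonpos (hfpos w hw) (hfanti hz hw hzw)
      (neg_nonpos.2 (by positivity))
  · intro x₀ hx₀ hx₀0 φ hφ
    have hx₀Ω : x₀ ∈ Ω := hRΩ (Metric.ball_subset_closedBall hx₀)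
    have hT := hsubh x₀ hx₀Ω φ hφ
    have h1 := (husub x₀ hx₀Ω hx₀0 (hneg x₀ hx₀Ω) φ hφ).trans
      (hessianOp_le_choose_mul_trace_pow hφ.1 hk (hadm x₀ hx₀Ω φ hφ))
    set T : ℝ := (hessianMatrix φ x₀).trace
    have hfx := hfpos _ (hneg x₀ hx₀Ω)
    have hx₀n : 0 < ‖x₀‖ := norm_pos_iff.2 hx₀0
    have hx₀1 : ‖x₀‖ ≤ 1 := (mem_ball_zero_iff.1 hx₀).le.trans hR1
    -- `C ≤ C ^ k` turns the bound into a `k`-th power, so that the root can be taken.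
    have h2 : (‖x₀‖ ^ (2 * s) * f (u x₀) ^ (1 / (k : ℝ))) ^ k ≤ (C * T) ^ k := by
      rw [mul_pow, mul_pow, ← Real.rpow_mul_natCast hx₀n.le, ← Real.rpow_mul_natCast hfx.le,
        one_div_mul_cancel hk0.ne', Real.rpow_one]
      exact h1.trans (mul_le_mul_of_nonneg_right (le_self_pow₀ hC (by lia)) (pow_nonneg hT k))
    have h3 := le_of_pow_le_pow_left₀ (by lia) (by positivity) h2
    have h4 : (‖x₀‖ ^ 2)⁻¹ ≤ ‖x₀‖ ^ (2 * s) := by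
      rw [← Real.rpow_natCast, ← Real.rpow_neg hx₀n.le]
      exact Real.rpow_le_rpow_of_exponent_ge hx₀n hx₀1 (by push_cast; linarith)
    have hfp : 0 < f (u x₀) ^ (1 / (k : ℝ)) := Real.rpow_pos_of_pos hfx _
    rw [Real.rpow_neg hfx.le, inv_mul_eq_div, one_div_mul_eq_div,
      div_le_div_iff₀ (by positivity) hfp]
    calc (‖x₀‖ ^ 2)⁻¹ * f (u x₀) ^ (1 / (k : ℝ))
        ≤ ‖x₀‖ ^ (2 * s) * f (u x₀) ^ (1 / (k : ℝ)) := by gcongr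
      _ ≤ C * T := h3
      _ = T * C := mul_comm _ _
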